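/- Call a graph twin-free if no two distinct vertices have the same open neighbourhood. For every integer $n \ge 4$, every twin-free tree $T$ with $n$ vertices has at least $f(n)$ maximal independent sets (independent sets not contained in any larger independent set), where $$f(n)=\begin{cases} 4\cdot 3^{\frac{n}{5}-1} & \text{if } n\equiv 0 \pmod 5,\\ 5\cdot 3^{\frac{n-6}{5}} & \text{if } n\equiv 1 \pmod 5,\\ 2\cdot 3^{\frac{n-2}{5}} & \text{if } n\equiv 2 \pmod 5,\\ 8\cdot 3^{\frac{n-8}{5}} & \text{if } n\equiv 3 \pmod 5,\\ 3^{\frac{n+1}{5}} & \text{if } n\equiv 4 \pmod 5. \end{cases}$$ This inequality is sharp: for every integer $n \ge 4$ there is a twin-free tree with $n$ vertices that has exactly $f(n)$ maximal independent sets. -/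

import Mathlib

/-- No two distinct vertices of `G` have the same (open) neighbourhood. -/
def SimpleGraph.IsTwinFree {V : Type*} (G : SimpleGraph V) : Prop :=
  ∀ ⦃u v : V⦄, G.neighborSet u = G.neighborSet v → u = v

/-- The number of inclusion-maximal independent sets of vertices of `G`. -/
noncomputable def SimpleGraph.numMaximalIndepSets {V : Type*} (G : SimpleGraph V) : ℕ :=
  {s : Set V | Maximal G.IsIndepSet s}.ncard

/-- The extremal function `f`, meant for `n ≥ 4`. For such `n` every exponent below is the quotient
by `5` of a nonnegative multiple of `5`, so no subtraction truncates and no division rounds. -/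
def twinFreeTreeBound (n : ℕ) : ℕ :=
  if n % 5 = 0 then 4 * 3 ^ (n / 5 - 1)
  else if n % 5 = 1 then 5 * 3 ^ ((n - 6) / 5)
  else if n % 5 = 2 then 2 * 3 ^ ((n - 2) / 5)
  else if n % 5 = 3 then 8 * 3 ^ ((n - 8) / 5)
  else 3 ^ ((n + 1) / 5)

/-- `twinFreeTreeBound` grows by a factor of at most `num / den` when `k` vertices are added. -/
def BoundGrowth (k : ℕ) (num den : ℤ) : Prop :=
  ∀ j ≥ 4, den * (twinFreeTreeBound (j + k) : ℤ) ≤ num * twinFreeTreeBound j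

lemma twinFreeTreeBound_values (q : ℕ) :
    twinFreeTreeBound (5 * q + 4) = 3 * 3 ^ q ∧ twinFreeTreeBound (5 * q + 5) = 4 * 3 ^ q ∧
    twinFreeTreeBound (5 * q + 6) = 5 * 3 ^ q ∧ twinFreeTreeBound (5 * q + 7) = 6 * 3 ^ q ∧
    twinFreeTreeBound (5 * q + 8) = 8 * 3 ^ q := by
  have h4 : (5 * q + 4) % 5 = 4 := by omega
  have h5 : (5 * q + 5) % 5 = 0 := by omega
  have h6 : (5 * q + 6) % 5 = 1 := by omega
  have h7 : (5 * q + 7) % 5 = 2 := by omega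
  have h8 : (5 * q + 8) % 5 = 3 := by omega
  have e4 : (5 * q + 4 + 1) / 5 = q + 1 := by omega
  have e6 : (5 * q + 6 - 6) / 5 = q := by omega
  have e7 : (5 * q + 7 - 2) / 5 = q + 1 := by omega
  have e8 : (5 * q + 8 - 8) / 5 = q := by omega
  simp only [twinFreeTreeBound, h4, h5, h6, h7, h8, e4, e6, e7, e8]
  norm_num [pow_succ]
  constructor <;> ring

lemma exists_eq_five_mul_add {j : ℕ} (hj : 4 ≤ j) :
    ∃ q, j = 5 * q + 4 ∨ j = 5 * q + 5 ∨ j = 5 * q + 6 ∨ j = 5 * q + 7 ∨ j = 5 * q + 8 :=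
  ⟨(j - 4) / 5, by omega⟩

lemma twinFreeTreeBound_add_five {j : ℕ} (hj : 4 ≤ j) :
    twinFreeTreeBound (j + 5) = 3 * twinFreeTreeBound j := by
  obtain ⟨q, hq⟩ := exists_eq_five_mul_add hj
  obtain ⟨h4, h5, h6, h7, h8⟩ := twinFreeTreeBound_values q
  obtain ⟨k4, k5, k6, k7, k8⟩ := twinFreeTreeBound_values (q + 1)
  have e (i : ℕ) : 5 * q + i + 5 = 5 * (q + 1) + i := by ring
  rcases hq with rfl | rfl | rfl | rfl | rfl <;> rw [e] <;>
    simp only [h4, h5, h6, h7, h8, k4, k5, k6, k7, k8, pow_succ] <;> ring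

lemma boundGrowth_of_base {k : ℕ} {num den : ℤ}
    (h : ∀ j ∈ Finset.Icc 4 8, den * (twinFreeTreeBound (j + k) : ℤ) ≤ num * twinFreeTreeBound j) :
    BoundGrowth k num den := by
  intro j
  induction j using Nat.strong_induction_on with
  | _ j ih =>
    intro hj
    by_cases hj8 : j ≤ 8
    · exact h j (Finset.mem_Icc.2 ⟨hj, hj8⟩)
    · obtain ⟨i, rfl⟩ : ∃ i, j = i + 5 := ⟨j - 5, by omega⟩
      have := ih i (by omega) (by omega)
      rw [show i + 5 + k = i + k + 5 by ring, twinFreeTreeBound_add_five (by omega),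
        twinFreeTreeBound_add_five (by omega)]
      push_cast
      linarith

lemma boundGrowth_two : BoundGrowth 2 5 3 := boundGrowth_of_base (by decide)
lemma boundGrowth_three : BoundGrowth 3 2 1 := boundGrowth_of_base (by decide)
lemma boundGrowth_four : BoundGrowth 4 8 3 := boundGrowth_of_base (by decide)
lemma boundGrowth_five : BoundGrowth 5 3 1 := boundGrowth_of_base (by decide)
lemma boundGrowth_six : BoundGrowth 6 4 1 := boundGrowth_of_base (by decide)
lemma boundGrowth_seven : BoundGrowth 7 5 1 := boundGrowth_of_base (by decide)
lemma boundGrowth_eight : BoundGrowth 8 6 1 := boundGrowth_of_base (by decide)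

/-- Nonempty collections of branches with at least two vertices each, to be hung on a common root:
`BranchForest n P Q B` says that there are `n` vertices in total, and that `P`, `Q`, `B` are the
products over the branches of the numbers `b + c`, `a + b`, `b`, where `a` and `b` count the maximal
independent sets of the branch with and without its root, and `c` counts the sets that become
maximal once the root of the branch is dominated from outside. -/
inductive BranchForest : ℕ → ℤ → ℤ → ℤ → Prop
  | pendant : BranchForest 2 1 2 1
  | stem {n P Q B} : BranchForest n P Q B → BranchForest (n + 1) Q (P + Q - B) (Q - B)
  | leafStem {n P Q B} : BranchForest n P Q B → BranchForest (n + 2) Q (P + Q) Q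
  | union {n P Q B n' P' Q' B'} : BranchForest n P Q B → BranchForest n' P' Q' B' →
      BranchForest (n + n') (P * P') (Q * Q') (B * B')

lemma BranchForest.bounds {n P Q B} (h : BranchForest n P Q B) :
    0 ≤ B ∧ B ≤ P ∧ P ≤ Q ∧ 2 ≤ n := by
  induction h with
  | pendant => norm_num
  | stem _ ih => omega
  | leafStem _ ih => omega
  | union _ _ ih ih' =>
    refine ⟨by nlinarith, ?_, ?_, by omega⟩
    · exact mul_le_mul ih.2.1 ih'.2.1 ih'.1 (by omega)
    · exact mul_le_mul ih.2.2.1 ih'.2.2.1 (by omega) (by omega)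

/-- `num` times the data `(P', Q', B')` is at most `den` times the data `(P, Q, B)`, in the order
that is preserved by all constructors of `BranchForest`. -/
structure DataLE (num den P' Q' B' P Q B : ℤ) : Prop where
  dominated : num * Q' ≤ den * Q
  free : num * (P' + Q') ≤ den * (P + Q)
  full : num * (P' + Q' - B') ≤ den * (P + Q - B)

lemma DataLE.stem {num den P' Q' B' P Q B : ℤ} (h : DataLE num den P' Q' B' P Q B) :
    DataLE num den Q' (P' + Q' - B') (Q' - B') Q (P + Q - B) (Q - B) := by
  obtain ⟨h1, h2, h3⟩ := h
  exact ⟨h3, by linarith, by linarith⟩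

lemma DataLE.leafStem {num den P' Q' B' P Q B : ℤ} (h : DataLE num den P' Q' B' P Q B) :
    DataLE num den Q' (P' + Q') Q' Q (P + Q) Q := by
  obtain ⟨h1, h2, h3⟩ := h
  exact ⟨h2, by linarith, by linarith⟩

lemma DataLE.mul_right {num den P' Q' B' P Q B P₀ Q₀ B₀ : ℤ} (h : DataLE num den P' Q' B' P Q B)
    (hB : 0 ≤ B₀) (hP : B₀ ≤ P₀) (hQ : P₀ ≤ Q₀) :
    DataLE num den (P' * P₀) (Q' * Q₀) (B' * B₀) (P * P₀) (Q * Q₀) (B * B₀) := by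
  obtain ⟨h1, h2, h3⟩ := h
  have k1 := mul_le_mul_of_nonneg_right h1 (hB.trans (hP.trans hQ))
  have k2 := mul_le_mul_of_nonneg_right h1 (sub_nonneg.2 hQ)
  have k3 := mul_le_mul_of_nonneg_right h2 (hB.trans hP)
  have k4 := mul_le_mul_of_nonneg_right h2 (sub_nonneg.2 hP)
  have k5 := mul_le_mul_of_nonneg_right h3 hB
  exact ⟨by linarith, by linarith, by linarith⟩

/-- The forest data dominate those of a smaller forest, by at least the growth of the bound. -/
def Reducible (n : ℕ) (P Q B : ℤ) : Prop :=
  ∃ k > 0, ∃ num den m P' Q' B', n = m + k ∧ BranchForest m P' Q' B' ∧ 0 < den ∧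
    BoundGrowth k num den ∧ DataLE num den P' Q' B' P Q B

/-- Branches that can be deleted from any larger forest. -/
def Removable (n : ℕ) (P Q B : ℤ) : Prop :=
  ∃ num den, 0 < den ∧ BoundGrowth n num den ∧ DataLE num den 1 1 1 P Q B

/-- The small branches that cannot be deleted. -/
inductive IsCoreBranch : ℕ → ℤ → ℤ → ℤ → Prop
  | two : IsCoreBranch 2 1 2 1
  | fork : IsCoreBranch 4 2 3 2
  | path : IsCoreBranch 4 2 3 1

/-- The branches that can be deleted, but from which no smaller forest can be split off. -/
inductive IsTailBranch : ℕ → ℤ → ℤ → ℤ → Prop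
  | three : IsTailBranch 3 2 2 1
  | five : IsTailBranch 5 3 3 1
  | six : IsTailBranch 6 3 5 2
  | six' : IsTailBranch 6 3 5 3
  | seven : IsTailBranch 7 5 5 2
  | eight : IsTailBranch 8 5 8 3

lemma IsTailBranch.removable {n P Q B} (h : IsTailBranch n P Q B) : Removable n P Q B := by
  cases h
  · exact ⟨_, _, by norm_num, boundGrowth_three, by norm_num, by norm_num, by norm_num⟩
  · exact ⟨_, _, by norm_num, boundGrowth_five, by norm_num, by norm_num, by norm_num⟩
  · exact ⟨_, _, by norm_num, boundGrowth_six, by norm_num, by norm_num, by norm_num⟩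
  · exact ⟨_, _, by norm_num, boundGrowth_six, by norm_num, by norm_num, by norm_num⟩
  · exact ⟨_, _, by norm_num, boundGrowth_seven, by norm_num, by norm_num, by norm_num⟩
  · exact ⟨_, _, by norm_num, boundGrowth_eight, by norm_num, by norm_num, by norm_num⟩

lemma Reducible.stem {n P Q B} (h : Reducible n P Q B) :
    Reducible (n + 1) Q (P + Q - B) (Q - B) := by
  obtain ⟨k, hk, num, den, m, P', Q', B', rfl, hF, hd, hg, hle⟩ := h
  exact ⟨k, hk, num, den, _, _, _, _, by ring, hF.stem, hd, hg, hle.stem⟩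

lemma Reducible.leafStem {n P Q B} (h : Reducible n P Q B) :
    Reducible (n + 2) Q (P + Q) Q := by
  obtain ⟨k, hk, num, den, m, P', Q', B', rfl, hF, hd, hg, hle⟩ := h
  exact ⟨k, hk, num, den, _, _, _, _, by ring, hF.leafStem, hd, hg, hle.leafStem⟩

lemma Reducible.union_right {n P Q B n₀ P₀ Q₀ B₀} (h : Reducible n P Q B)
    (h₀ : BranchForest n₀ P₀ Q₀ B₀) : Reducible (n + n₀) (P * P₀) (Q * Q₀) (B * B₀) := by
  obtain ⟨k, hk, num, den, m, P', Q', B', rfl, hF, hd, hg, hle⟩ := h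
  obtain ⟨h1, h2, h3, _⟩ := h₀.bounds
  exact ⟨k, hk, num, den, _, _, _, _, by ring, hF.union h₀, hd, hg, hle.mul_right h1 h2 h3⟩

lemma Removable.union_right {n P Q B n₀ P₀ Q₀ B₀} (hn : 0 < n) (h : Removable n P Q B)
    (h₀ : BranchForest n₀ P₀ Q₀ B₀) : Reducible (n + n₀) (P * P₀) (Q * Q₀) (B * B₀) := by
  obtain ⟨num, den, hd, hg, hle⟩ := h
  obtain ⟨h1, h2, h3, _⟩ := h₀.bounds
  exact ⟨n, hn, num, den, _, _, _, _, by ring, h₀, hd, hg, by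
    simpa only [one_mul] using hle.mul_right h1 h2 h3⟩

lemma BranchForest.stem_pendant : BranchForest 3 2 2 1 := by
  simpa using BranchForest.pendant.stem

lemma BranchForest.fork : BranchForest 4 2 3 2 := by
  simpa using BranchForest.pendant.leafStem

lemma BranchForest.path : BranchForest 4 2 3 1 := by
  simpa using BranchForest.stem_pendant.stem

lemma BranchForest.six' : BranchForest 6 3 5 3 := by
  simpa using BranchForest.path.leafStem

/-- The data are reducible, or those of one of finitely many single branches. -/
def Classified (n : ℕ) (P Q B : ℤ) : Prop :=
  Reducible n P Q B ∨ IsCoreBranch n P Q B ∨ IsTailBranch n P Q B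

lemma Classified.stem {n P Q B} (h : Classified n P Q B) :
    Classified (n + 1) Q (P + Q - B) (Q - B) := by
  rcases h with h | h | h
  · exact .inl h.stem
  · cases h <;> norm_num
    · exact .inr (.inr .three)
    · exact .inr (.inr .five)
    · exact .inl ⟨3, by norm_num, _, _, _, _, _, _, rfl, .pendant, by norm_num,
        boundGrowth_three, by norm_num, by norm_num, by norm_num⟩
  · cases h <;> norm_num
    · exact .inr (.inl .path)
    · exact .inr (.inr .six)
    · exact .inl ⟨3, by norm_num, _, _, _, _, _, _, rfl, .fork, by norm_num,
        boundGrowth_three, by norm_num, by norm_num, by norm_num⟩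
    · exact .inr (.inr .seven)
    · exact .inr (.inr .eight)
    · exact .inl ⟨3, by norm_num, _, _, _, _, _, _, rfl, .six', by norm_num,
        boundGrowth_three, by norm_num, by norm_num, by norm_num⟩

lemma Classified.leafStem {n P Q B} (h : Classified n P Q B) :
    Classified (n + 2) Q (P + Q) Q := by
  rcases h with h | h | h
  · exact .inl h.leafStem
  · cases h <;> norm_num
    · exact .inr (.inl .fork)
    · exact .inr (.inr .six')
    · exact .inr (.inr .six')
  · have : ∀ {k num den}, k + 2 = n + 2 → 0 < k → (0 : ℤ) < den → BoundGrowth k num den →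
        DataLE num den 1 2 1 Q (P + Q) Q → Classified (n + 2) Q (P + Q) Q :=
      fun {k num den} h1 h2 h3 h4 h5 ↦
        .inl ⟨k, h2, num, den, 2, 1, 2, 1, by omega, .pendant, h3, h4, h5⟩
    cases h
    · exact this rfl (by norm_num) (by norm_num) boundGrowth_three
        ⟨by norm_num, by norm_num, by norm_num⟩
    · exact this rfl (by norm_num) (by norm_num) boundGrowth_five
        ⟨by norm_num, by norm_num, by norm_num⟩
    · exact this rfl (by norm_num) (by norm_num) boundGrowth_six
        ⟨by norm_num, by norm_num, by norm_num⟩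
    · exact this rfl (by norm_num) (by norm_num) boundGrowth_six
        ⟨by norm_num, by norm_num, by norm_num⟩
    · exact this rfl (by norm_num) (by norm_num) boundGrowth_seven
        ⟨by norm_num, by norm_num, by norm_num⟩
    · exact this rfl (by norm_num) (by norm_num) boundGrowth_eight
        ⟨by norm_num, by norm_num, by norm_num⟩

lemma IsCoreBranch.union {n P Q B n' P' Q' B'} (h : IsCoreBranch n P Q B)
    (h' : IsCoreBranch n' P' Q' B') : Reducible (n + n') (P * P') (Q * Q') (B * B') := by
  cases h <;> cases h'
  · exact ⟨2, by norm_num, _, _, _, _, _, _, rfl, .pendant, by norm_num,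
      boundGrowth_two, by norm_num, by norm_num, by norm_num⟩
  all_goals first
    | exact ⟨4, by norm_num, _, _, _, _, _, _, rfl, .pendant, by norm_num,
        boundGrowth_four, by norm_num, by norm_num, by norm_num⟩
    | exact ⟨5, by norm_num, _, _, _, _, _, _, rfl, .stem_pendant, by norm_num,
        boundGrowth_five, by norm_num, by norm_num, by norm_num⟩

lemma IsTailBranch.pos {n P Q B} (h : IsTailBranch n P Q B) : 0 < n := by
  cases h <;> norm_num

lemma BranchForest.classified {n P Q B} (h : BranchForest n P Q B) : Classified n P Q B := by
  induction h with
  | pendant => exact .inr (.inl .two)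
  | stem _ ih => exact ih.stem
  | leafStem _ ih => exact ih.leafStem
  | @union n P Q B n' P' Q' B' h h' ih ih' =>
    have swap : Reducible (n' + n) (P' * P) (Q' * Q) (B' * B) →
        Reducible (n + n') (P * P') (Q * Q') (B * B') := by
      rw [add_comm, mul_comm P', mul_comm Q', mul_comm B']; exact id
    left
    rcases ih with ih | ih | ih
    · exact ih.union_right h'
    · rcases ih' with ih' | ih' | ih'
      · exact swap (ih'.union_right h)
      · exact ih.union ih'
      · exact swap (ih'.removable.union_right ih'.pos h)
    · exact ih.removable.union_right ih.pos h'

/-- The lower bound for trees whose root has a leaf child and carries the given branches. -/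
theorem BranchForest.twinFreeTreeBound_le {n P Q B} (h : BranchForest n P Q B) :
    (twinFreeTreeBound (n + 2) : ℤ) ≤ P + Q := by
  induction n using Nat.strong_induction_on generalizing P Q B with
  | _ n ih =>
    rcases h.classified with ⟨k, hk, num, den, m, P', Q', B', rfl, hF, hd, hg, hle⟩ | h | h
    · have h1 := ih m (by omega) hF
      have h2 := hg (m + 2) (by have := hF.bounds; omega)
      have h3 : 0 ≤ num := by
        by_contra hneg
        push Not at hneg
        have h4 : (0 : ℤ) < twinFreeTreeBound (m + 2) := by
          unfold twinFreeTreeBound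
          split_ifs <;> positivity
        nlinarith [mul_pos_of_neg_of_neg hneg (neg_lt_zero.2 h4), Int.natCast_nonneg
          (twinFreeTreeBound (m + 2 + k)), mul_nonneg hd.le (Int.natCast_nonneg
          (twinFreeTreeBound (m + 2 + k)))]
      have h5 := hle.free
      have h6 := mul_le_mul_of_nonneg_left h1 h3
      rw [show m + k + 2 = m + 2 + k by ring]
      exact le_of_mul_le_mul_left (h2.trans (h6.trans h5)) hd
    · cases h <;> decide
    · cases h <;> decide

namespace SimpleGraph

section counting
variable {V W : Type*} (G : SimpleGraph V) (H : SimpleGraph W) (v : V) (w : W)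

/-- Independent sets that dominate every vertex outside them, except possibly the root `v`. -/
def IsNearMaximal (s : Set V) : Prop :=
  G.IsIndepSet s ∧ ∀ x ∉ s, x ≠ v → ∃ y ∈ s, G.Adj x y

/-- The maximal independent sets through the root. -/
def setsWithRoot : Set (Set V) := {s | G.IsNearMaximal v s ∧ v ∈ s}

/-- The maximal independent sets that avoid the root. -/
def setsAvoidingRoot : Set (Set V) := {s | G.IsNearMaximal v s ∧ v ∉ s ∧ ∃ y ∈ s, G.Adj v y}

/-- The sets that leave just the root undominated. -/
def setsExposingRoot : Set (Set V) := {s | G.IsNearMaximal v s ∧ v ∉ s ∧ ¬ ∃ y ∈ s, G.Adj v y}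

/-- The sizes of `setsWithRoot`, `setsAvoidingRoot` and `setsExposingRoot`. -/
def HasRootCounts (a b c : ℕ) : Prop :=
  (G.setsWithRoot v).ncard = a ∧ (G.setsAvoidingRoot v).ncard = b ∧
    (G.setsExposingRoot v).ncard = c

/-- The disjoint union of `G` and `H` with an additional edge from `v` to `w`. -/
def edgeJoin : SimpleGraph (V ⊕ W) where
  Adj x y := match x, y with
    | .inl x, .inl y => G.Adj x y
    | .inr x, .inr y => H.Adj x y
    | .inl x, .inr y => x = v ∧ y = w
    | .inr x, .inl y => y = v ∧ x = w
  symm := ⟨by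
    rintro (x | x) (y | y) h
    · exact h.symm
    · exact h
    · exact h
    · exact h.symm⟩
  loopless := ⟨by rintro (x | x) h; exacts [G.loopless.irrefl _ h, H.loopless.irrefl _ h]⟩

variable {G H v w}

@[simp] lemma edgeJoin_inl_inl {x y} : (G.edgeJoin H v w).Adj (.inl x) (.inl y) ↔ G.Adj x y := .rfl
@[simp] lemma edgeJoin_inr_inr {x y} : (G.edgeJoin H v w).Adj (.inr x) (.inr y) ↔ H.Adj x y := .rfl
@[simp] lemma edgeJoin_inl_inr {x y} :
    (G.edgeJoin H v w).Adj (.inl x) (.inr y) ↔ x = v ∧ y = w := .rfl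
@[simp] lemma edgeJoin_inr_inl {x y} :
    (G.edgeJoin H v w).Adj (.inr x) (.inl y) ↔ y = v ∧ x = w := .rfl

lemma maximal_isIndepSet_iff' {s : Set V} : Maximal G.IsIndepSet s ↔
    G.IsIndepSet s ∧ ∀ x ∉ s, ∃ y ∈ s, G.Adj x y := by
  constructor
  · refine fun h ↦ ⟨h.prop, fun x hx ↦ ?_⟩
    by_contra! hne
    refine hx (h.le_of_ge (y := insert x s) ?_ (Set.subset_insert _ _) (Set.mem_insert _ _))
    exact h.prop.insert fun y hy _ ↦ ⟨hne y hy, fun hyx ↦ hne y hy hyx.symm⟩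
  · rintro ⟨h, hd⟩
    refine ⟨h, fun t ht hst x hx ↦ ?_⟩
    by_contra hxs
    obtain ⟨y, hy, hxy⟩ := hd x hxs
    exact ht hx (hst hy) hxy.ne hxy

lemma HasRootCounts.numMaximalIndepSets_eq [Finite V] {a b c : ℕ} (h : G.HasRootCounts v a b c) :
    G.numMaximalIndepSets = a + b := by
  rw [← h.1, ← h.2.1, ← Set.ncard_union_eq]
  · unfold numMaximalIndepSets setsWithRoot setsAvoidingRoot IsNearMaximal
    congr 1
    ext s
    simp only [maximal_isIndepSet_iff', Set.mem_ofPred_eq, Set.mem_union]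
    constructor
    · rintro ⟨h1, h2⟩
      by_cases hv : v ∈ s
      · exact .inl ⟨⟨h1, fun x hx _ ↦ h2 x hx⟩, hv⟩
      · exact .inr ⟨⟨h1, fun x hx _ ↦ h2 x hx⟩, hv, h2 v hv⟩
    · rintro (⟨⟨h1, h2⟩, hv⟩ | ⟨⟨h1, h2⟩, hv, hd⟩)
      · exact ⟨h1, fun x hx ↦ h2 x hx fun e ↦ hx (e ▸ hv)⟩
      · refine ⟨h1, fun x hx ↦ ?_⟩
        by_cases e : x = v
        · exact e ▸ hd
        · exact h2 x hx e
  · exact Set.disjoint_left.2 fun s hs hs' ↦ hs'.2.1 hs.2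

/-- The set with parts `s` and `t` in a disjoint union. -/
def sumSet (s : Set V) (t : Set W) : Set (V ⊕ W) := Sum.inl '' s ∪ Sum.inr '' t

@[simp] lemma inl_mem_sumSet {s : Set V} {t : Set W} {x : V} : Sum.inl x ∈ sumSet s t ↔ x ∈ s := by
  simp [sumSet]

@[simp] lemma inr_mem_sumSet {s : Set V} {t : Set W} {x : W} : Sum.inr x ∈ sumSet s t ↔ x ∈ t := by
  simp [sumSet]

lemma isIndepSet_edgeJoin {s : Set V} {t : Set W} :
    (G.edgeJoin H v w).IsIndepSet (sumSet s t) ↔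
      G.IsIndepSet s ∧ H.IsIndepSet t ∧ ¬ (v ∈ s ∧ w ∈ t) := by
  constructor
  · intro h
    refine ⟨fun x hx y hy hxy ↦ ?_, fun x hx y hy hxy ↦ ?_, fun ⟨hv, hw⟩ ↦ ?_⟩
    · exact h (inl_mem_sumSet.2 hx) (inl_mem_sumSet.2 hy) (by simpa using hxy)
    · exact h (inr_mem_sumSet.2 hx) (inr_mem_sumSet.2 hy) (by simpa using hxy)
    · exact h (inl_mem_sumSet.2 hv) (inr_mem_sumSet.2 hw) (by simp) ⟨rfl, rfl⟩
  · rintro ⟨h1, h2, h3⟩ (x | x) hx (y | y) hy hxy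
    · exact h1 (by simpa using hx) (by simpa using hy) (by simpa using hxy)
    · rintro ⟨rfl, rfl⟩
      exact h3 ⟨by simpa using hx, by simpa using hy⟩
    · rintro ⟨rfl, rfl⟩
      exact h3 ⟨by simpa using hy, by simpa using hx⟩
    · exact h2 (by simpa using hx) (by simpa using hy) (by simpa using hxy)

lemma exists_edgeJoin_adj_inl {s : Set V} {t : Set W} {x : V} :
    (∃ y ∈ sumSet s t, (G.edgeJoin H v w).Adj (.inl x) y) ↔
      (∃ y ∈ s, G.Adj x y) ∨ (x = v ∧ w ∈ t) := by
  simp [and_comm]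

lemma exists_edgeJoin_adj_inr {s : Set V} {t : Set W} {x : W} :
    (∃ y ∈ sumSet s t, (G.edgeJoin H v w).Adj (.inr x) y) ↔
      (∃ y ∈ t, H.Adj x y) ∨ (x = w ∧ v ∈ s) := by
  simp [or_comm, and_comm]

lemma isNearMaximal_edgeJoin {s : Set V} {t : Set W} :
    (G.edgeJoin H v w).IsNearMaximal (.inl v) (sumSet s t) ↔
      G.IsNearMaximal v s ∧ H.IsNearMaximal w t ∧ ¬ (v ∈ s ∧ w ∈ t) ∧
        (w ∉ t → (∃ y ∈ t, H.Adj w y) ∨ v ∈ s) := by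
  simp only [IsNearMaximal, isIndepSet_edgeJoin, Sum.forall, exists_edgeJoin_adj_inl,
    exists_edgeJoin_adj_inr]
  simp only [inl_mem_sumSet, inr_mem_sumSet, Sum.inl.injEq, reduceCtorEq, ne_eq,
    not_false_eq_true, forall_true_left]
  constructor
  · rintro ⟨⟨h1, h2, h3⟩, h4, h5⟩
    refine ⟨⟨h1, fun x hx hxv ↦ ?_⟩, ⟨h2, fun x hx hxw ↦ ?_⟩, h3, fun hw ↦ ?_⟩
    · simpa [hxv] using h4 x hx hxv
    · simpa [hxw] using h5 x (by simpa using hx)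
    · simpa using h5 w (by simpa using hw)
  · rintro ⟨⟨h1, h4⟩, ⟨h2, h5⟩, h3, h6⟩
    refine ⟨⟨h1, h2, h3⟩, fun x hx hxv ↦ .inl (h4 x hx hxv), fun x hx ↦ ?_⟩
    have hx' : x ∉ t := by simpa using hx
    by_cases e : x = w
    · subst e
      simpa using h6 hx'
    · exact .inl (h5 x hx' e)

lemma ncard_eq_of_sum_iff [Finite V] [Finite W] {S : Set (Set (V ⊕ W))} {A : Set (Set V × Set W)}
    (h : ∀ s t, sumSet s t ∈ S ↔ (s, t) ∈ A) :
    S.ncard = A.ncard := by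
  have hsum (u : Set (V ⊕ W)) : sumSet (Sum.inl ⁻¹' u) (Sum.inr ⁻¹' u) = u := by
    ext (x | x) <;> simp
  refine Set.ncard_congr (fun u _ ↦ (Sum.inl ⁻¹' u, Sum.inr ⁻¹' u)) (fun u hu ↦ ?_)
    (fun u u' _ _ he ↦ ?_) (fun p hp ↦ ⟨sumSet p.1 p.2, (h _ _).2 hp, ?_⟩)
  · rwa [← h, hsum]
  · obtain ⟨h1, h2⟩ := Prod.mk.inj he
    rw [← hsum u, ← hsum u', h1, h2]
  · ext x <;> simp

lemma disjoint_avoiding_exposing :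
    Disjoint (G.setsAvoidingRoot v) (G.setsExposingRoot v) :=
  Set.disjoint_left.2 fun _ ⟨_, _, y, hy, hxy⟩ ⟨_, _, h⟩ ↦ h ⟨y, hy, hxy⟩

lemma disjoint_with_avoiding : Disjoint (G.setsWithRoot v) (G.setsAvoidingRoot v) :=
  Set.disjoint_left.2 fun _ ⟨_, h⟩ ⟨_, h', _⟩ ↦ h' h

/-- How the counts behave when an edge between the roots is added. -/
lemma HasRootCounts.edgeJoin [Finite V] [Finite W] {a b c a' b' c' : ℕ}
    (hG : G.HasRootCounts v a b c) (hH : H.HasRootCounts w a' b' c') :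
    (G.edgeJoin H v w).HasRootCounts (.inl v) (a * (b' + c')) (b * (a' + b') + c * a')
      (c * b') := by
  obtain ⟨rfl, rfl, rfl⟩ := hG
  obtain ⟨rfl, rfl, rfl⟩ := hH
  refine ⟨?_, ?_, ?_⟩
  · rw [← Set.ncard_union_eq disjoint_avoiding_exposing, ← Set.ncard_prod]
    refine ncard_eq_of_sum_iff fun s t ↦ ?_
    simp only [setsWithRoot, setsAvoidingRoot, setsExposingRoot, Set.mem_ofPred_eq, Set.mem_prod,
      Set.mem_union, isNearMaximal_edgeJoin, inl_mem_sumSet]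
    generalize G.IsNearMaximal v s = p, H.IsNearMaximal w t = q, (v ∈ s) = i, (w ∈ t) = j,
      (∃ y ∈ t, H.Adj w y) = d
    tauto
  · rw [← Set.ncard_union_eq disjoint_with_avoiding, ← Set.ncard_prod, ← Set.ncard_prod,
      ← Set.ncard_union_eq]
    · refine ncard_eq_of_sum_iff fun s t ↦ ?_
      simp only [setsWithRoot, setsAvoidingRoot, setsExposingRoot, Set.mem_ofPred_eq, Set.mem_prod,
        Set.mem_union, isNearMaximal_edgeJoin, inl_mem_sumSet, exists_edgeJoin_adj_inl, true_and]
      generalize G.IsNearMaximal v s = p, H.IsNearMaximal w t = q, (v ∈ s) = i, (w ∈ t) = j,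
        (∃ y ∈ s, G.Adj v y) = d, (∃ y ∈ t, H.Adj w y) = d'
      tauto
    · exact Set.Disjoint.set_prod_left disjoint_avoiding_exposing _ _
  · rw [← Set.ncard_prod]
    refine ncard_eq_of_sum_iff fun s t ↦ ?_
    simp only [setsAvoidingRoot, setsExposingRoot, Set.mem_ofPred_eq, Set.mem_prod,
      isNearMaximal_edgeJoin, inl_mem_sumSet, exists_edgeJoin_adj_inl, true_and]
    generalize G.IsNearMaximal v s = p, H.IsNearMaximal w t = q, (v ∈ s) = i, (w ∈ t) = j,
      (∃ y ∈ s, G.Adj v y) = d, (∃ y ∈ t, H.Adj w y) = d'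
    tauto

lemma hasRootCounts_of_subsingleton [Subsingleton V] : G.HasRootCounts v 1 0 1 := by
  have hadj (x y) : ¬ G.Adj x y := fun h ↦ h.ne (Subsingleton.elim _ _)
  refine ⟨?_, ?_, ?_⟩
  · rw [Set.ncard_eq_one]
    refine ⟨{v}, Set.ext fun s ↦ ⟨fun hs ↦ ?_, ?_⟩⟩
    · exact Set.ext fun x ↦ by simp [Subsingleton.elim x v, hs.2]
    · rintro rfl
      exact ⟨⟨by simp [isIndepSet_iff], fun x hx hxv ↦ absurd (Subsingleton.elim _ _) hxv⟩, rfl⟩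
  · simp [setsAvoidingRoot, hadj]
  · rw [Set.ncard_eq_one]
    refine ⟨∅, Set.ext fun s ↦ ⟨fun hs ↦ ?_, ?_⟩⟩
    · exact Set.ext fun x ↦ by simp [Subsingleton.elim x v, hs.2.1]
    · rintro rfl
      exact ⟨⟨by simp [isIndepSet_iff], fun x hx hxv ↦ absurd (Subsingleton.elim _ _) hxv⟩,
        by simp, by simp⟩

lemma IsNearMaximal.of_iso (e : G ≃g H) {s : Set V} (h : G.IsNearMaximal v s) :
    H.IsNearMaximal (e v) (e '' s) := by
  refine ⟨?_, fun x hx hxv ↦ ?_⟩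
  · rintro _ ⟨x, hx, rfl⟩ _ ⟨y, hy, rfl⟩ hxy
    rw [e.map_adj_iff]
    exact h.1 hx hy fun e ↦ hxy (e ▸ rfl)
  · obtain ⟨x, rfl⟩ := e.surjective x
    obtain ⟨y, hy, hxy⟩ := h.2 x (fun hxs ↦ hx ⟨x, hxs, rfl⟩) (fun e ↦ hxv (e ▸ rfl))
    exact ⟨_, ⟨y, hy, rfl⟩, e.map_adj_iff.2 hxy⟩

lemma isNearMaximal_image_iso (e : G ≃g H) {s : Set V} :
    H.IsNearMaximal (e v) (e '' s) ↔ G.IsNearMaximal v s := by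
  refine ⟨fun h ↦ ?_, .of_iso e⟩
  have := h.of_iso e.symm
  simpa [Set.image_image] using this

lemma HasRootCounts.of_iso (e : G ≃g H) {a b c : ℕ} (h : G.HasRootCounts v a b c) :
    H.HasRootCounts (e v) a b c := by
  have key {S : Set (Set V)} {T : Set (Set W)} (h : ∀ s, e '' s ∈ T ↔ s ∈ S) :
      T.ncard = S.ncard := by
    have : (fun s ↦ e '' s) '' S = T := by
      ext t
      obtain ⟨s, rfl⟩ := e.surjective.image_surjective t
      rw [h]
      exact e.injective.image_injective.mem_set_image
    rw [← this]
    exact Set.ncard_image_of_injective _ e.injective.image_injective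
  obtain ⟨rfl, rfl, rfl⟩ := h
  refine ⟨key fun s ↦ ?_, key fun s ↦ ?_, key fun s ↦ ?_⟩
  · simp only [setsWithRoot, Set.mem_ofPred_eq, isNearMaximal_image_iso,
      e.injective.mem_set_image]
  · simp only [setsAvoidingRoot, Set.mem_ofPred_eq, isNearMaximal_image_iso,
      e.injective.mem_set_image, Set.exists_mem_image, e.map_adj_iff]
  · simp only [setsExposingRoot, Set.mem_ofPred_eq, isNearMaximal_image_iso,
      e.injective.mem_set_image, Set.exists_mem_image, e.map_adj_iff]

end counting

end SimpleGraph

namespace SimpleGraph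
universe u
variable {V W : Type u} {G : SimpleGraph V} {H : SimpleGraph W} {v : V} {w : W}

/-- No two vertices other than the root `v` are twins. -/
def IsTwinFreeOff (G : SimpleGraph V) (v : V) : Prop :=
  ∀ ⦃x y⦄, x ≠ v → y ≠ v → (∀ z, G.Adj x z ↔ G.Adj y z) → x = y

lemma IsTwinFree.isTwinFreeOff (h : G.IsTwinFree) : G.IsTwinFreeOff v :=
  fun _ _ _ _ hxy ↦ h (Set.ext hxy)

lemma IsTwinFreeOff.of_iso (e : G ≃g H) (h : H.IsTwinFreeOff (e v)) : G.IsTwinFreeOff v := by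
  intro x y hx hy hxy
  refine e.injective (h (e.injective.ne hx) (e.injective.ne hy) fun z ↦ ?_)
  obtain ⟨z, rfl⟩ := e.surjective z
  simpa only [e.map_adj_iff] using hxy z

lemma IsTwinFreeOff.of_edgeJoin_left (h : (G.edgeJoin H v w).IsTwinFreeOff (.inl v)) :
    G.IsTwinFreeOff v := by
  intro x y hx hy hxy
  refine Sum.inl_injective (h (by simpa using hx) (by simpa using hy) ?_)
  rintro (z | z)
  · exact hxy z
  · simp [hx, hy]

lemma IsTwinFreeOff.of_edgeJoin_right (h : (G.edgeJoin H v w).IsTwinFreeOff (.inl v)) :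
    H.IsTwinFreeOff w := by
  intro x y hx hy hxy
  refine Sum.inr_injective (h (by simp) (by simp) ?_)
  rintro (z | z)
  · simp [hx, hy]
  · exact hxy z

lemma connected_induce_of_reachable {D : SimpleGraph V} (hDG : D ≤ G) {S : Set V} {r : V}
    (hr : r ∈ S) (hcl : ∀ x ∈ S, ∀ y, D.Adj x y → y ∈ S) (h : ∀ x ∈ S, D.Reachable r x) :
    (G.induce S).Connected := by
  have key : ∀ x, D.Reachable r x → ∃ hx : x ∈ S, (G.induce S).Reachable ⟨r, hr⟩ ⟨x, hx⟩ := by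
    intro x hx
    rw [reachable_iff_reflTransGen] at hx
    induction hx with
    | refl => exact ⟨hr, .refl _⟩
    | tail _ hyz ih =>
      obtain ⟨hy, hry⟩ := ih
      exact ⟨hcl _ hy _ hyz, hry.trans (Adj.reachable (hDG hyz))⟩
  have : ∀ x : S, (G.induce S).Reachable ⟨r, hr⟩ x := fun x ↦ (key x (h x x.2)).2
  exact { preconnected := fun x y ↦ (this x).symm.trans (this y), nonempty := ⟨⟨r, hr⟩⟩ }

/-- A tree splits along any of its edges. -/
lemma IsTree.exists_edgeJoin_iso [Finite V] (hG : G.IsTree) {w : V} (hvw : G.Adj v w) :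
    ∃ (A B : Type u) (_ : Finite A) (_ : Finite B) (K : SimpleGraph A) (L : SimpleGraph B)
      (a : A) (b : B) (e : K.edgeJoin L a b ≃g G),
      K.IsTree ∧ L.IsTree ∧ e (.inl a) = v ∧ e (.inr b) = w := by
  classical
  set D := G.deleteEdges {s(v, w)} with hD
  let S : Set V := {x | D.Reachable v x}
  have hDG : ∀ {x y}, D.Adj x y ↔ G.Adj x y ∧ s(x, y) ≠ s(v, w) := by simp [hD]
  have hvS : v ∈ S := Reachable.refl v
  have hwS : w ∉ S := by
    have := isAcyclic_iff_forall_adj_isBridge.1 hG.2 hvw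
    rw [isBridge_iff] at this
    exact this
  have hcross : ∀ {x y}, x ∈ S → y ∉ S → (G.Adj x y ↔ x = v ∧ y = w) := by
    intro x y hx hy
    constructor
    · intro hxy
      by_contra hne
      refine hy (hx.trans (Adj.reachable (hDG.2 ⟨hxy, fun he ↦ hne ?_⟩)))
      rcases Sym2.eq_iff.1 he with h | ⟨rfl, rfl⟩
      · exact h
      · exact absurd hx hwS
    · rintro ⟨rfl, rfl⟩
      exact hvw
  have hside : ∀ x, D.Reachable v x ∨ D.Reachable w x := by
    intro x
    have := hG.1.preconnected v x
    rw [reachable_iff_reflTransGen] at this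
    induction this with
    | refl => exact .inl (.refl _)
    | @tail y z _ hyz ih =>
      by_cases he : s(y, z) = s(v, w)
      · rcases Sym2.eq_iff.1 he with ⟨_, rfl⟩ | ⟨_, rfl⟩
        · exact .inr (.refl _)
        · exact .inl (.refl _)
      · have hr : D.Reachable y z := Adj.reachable (hDG.2 ⟨hyz, he⟩)
        exact ih.imp (·.trans hr) (·.trans hr)
  have hle : D ≤ G := fun x y h ↦ (hDG.1 h).1
  refine ⟨S, (Sᶜ : Set V), inferInstance, inferInstance, G.induce S, G.induce Sᶜ, ⟨v, hvS⟩,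
    ⟨w, hwS⟩, ⟨Equiv.Set.sumCompl S, ?_⟩, ⟨?_, hG.2.induce S⟩, ⟨?_, hG.2.induce Sᶜ⟩, rfl, rfl⟩
  · rintro (⟨x, hx⟩ | ⟨x, hx⟩) (⟨y, hy⟩ | ⟨y, hy⟩)
    · rfl
    · simpa using hcross hx hy
    · simpa [adj_comm] using hcross hy hx
    · rfl
  · exact connected_induce_of_reachable hle hvS
      (fun x hx y hxy ↦ Reachable.trans hx hxy.reachable) fun x hx ↦ hx
  · refine connected_induce_of_reachable hle hwS
      (fun x hx y hxy hy ↦ hx (Reachable.trans hy hxy.symm.reachable)) fun x hx ↦ ?_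
    exact (hside x).resolve_left hx

/-- Forest data of the branches with at least two vertices, where there may be no such branch. -/
def BranchForestOrEmpty (n : ℕ) (P Q B : ℤ) : Prop :=
  (n = 0 ∧ P = 1 ∧ Q = 1 ∧ B = 1) ∨ BranchForest n P Q B

/-- The counts of a rooted tree without leaves at the root, in terms of the branches. -/
def IsBareRoot (G : SimpleGraph V) (v : V) : Prop :=
  ∃ (n : ℕ) (P Q B : ℤ) (a b c : ℕ), BranchForestOrEmpty n P Q B ∧ G.HasRootCounts v a b c ∧
    Nat.card V = n + 1 ∧ (a : ℤ) = P ∧ (b + c : ℤ) = Q ∧ (c : ℤ) = B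

/-- The counts of a rooted tree with a leaf at the root, in terms of the other branches. -/
def IsLeafyRoot (G : SimpleGraph V) (v : V) : Prop :=
  ∃ (n : ℕ) (P Q B : ℤ) (a b c : ℕ), BranchForestOrEmpty n P Q B ∧ G.HasRootCounts v a b c ∧
    Nat.card V = n + 2 ∧ (a : ℤ) = P ∧ (b : ℤ) = Q ∧ c = 0

lemma _root_.BranchForest.cast {n n' : ℕ} {P Q B P' Q' B' : ℤ} (h : BranchForest n P Q B)
    (hn : n = n') (hP : P = P') (hQ : Q = Q') (hB : B = B') : BranchForest n' P' Q' B' := by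
  subst hn hP hQ hB
  exact h

lemma IsBareRoot.branchForest (h : G.IsBareRoot v) (hV : 2 ≤ Nat.card V) :
    ∃ a b c : ℕ, G.HasRootCounts v a b c ∧ BranchForest (Nat.card V) (b + c) (a + b) b := by
  obtain ⟨n, P, Q, B, a, b, c, hF, hc, hn, ha, hb, hB⟩ := h
  rcases hF with ⟨rfl, _⟩ | hF
  · omega
  · exact ⟨a, b, c, hc, hF.stem.cast hn.symm (by omega) (by omega) (by omega)⟩

lemma IsLeafyRoot.branchForest (h : G.IsLeafyRoot v) :
    ∃ a b c : ℕ, G.HasRootCounts v a b c ∧ BranchForest (Nat.card V) (b + c) (a + b) b := by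
  obtain ⟨n, P, Q, B, a, b, c, hF, hc, hn, ha, hb, hB⟩ := h
  rcases hF with ⟨rfl, h1, h2, h3⟩ | hF
  · exact ⟨a, b, c, hc, BranchForest.pendant.cast hn.symm (by omega) (by omega) (by omega)⟩
  · exact ⟨a, b, c, hc, hF.leafStem.cast hn.symm (by omega) (by omega) (by omega)⟩

lemma _root_.BranchForest.union_orEmpty {n n' : ℕ} {P Q B P' Q' B' : ℤ}
    (h : BranchForest n P Q B) (h' : BranchForestOrEmpty n' P' Q' B') :
    BranchForest (n' + n) (P' * P) (Q' * Q) (B' * B) := by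
  rcases h' with ⟨rfl, rfl, rfl, rfl⟩ | h'
  · simpa using h
  · exact h'.union h

lemma IsBareRoot.edgeJoin_branch [Finite V] [Finite W] (h : G.IsBareRoot v) {a b c : ℕ}
    (hH : H.HasRootCounts w a b c) (hF : BranchForest (Nat.card W) (b + c) (a + b) b) :
    (G.edgeJoin H v w).IsBareRoot (.inl v) := by
  obtain ⟨n, P, Q, B, a', b', c', hF', hc, hn, rfl, rfl, rfl⟩ := h
  refine ⟨_, _, _, _, _, _, _, .inr (hF.union_orEmpty hF'), hc.edgeJoin hH, ?_, ?_, ?_, ?_⟩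
  · rw [Nat.card_sum, hn]; ring
  all_goals push_cast; ring

lemma IsLeafyRoot.edgeJoin_branch [Finite V] [Finite W] (h : G.IsLeafyRoot v) {a b c : ℕ}
    (hH : H.HasRootCounts w a b c) (hF : BranchForest (Nat.card W) (b + c) (a + b) b) :
    (G.edgeJoin H v w).IsLeafyRoot (.inl v) := by
  obtain ⟨n, P, Q, B, a', b', c', hF', hc, hn, rfl, rfl, rfl⟩ := h
  refine ⟨_, _, _, _, _, _, _, .inr (hF.union_orEmpty hF'), hc.edgeJoin hH, ?_, ?_, ?_, ?_⟩
  · rw [Nat.card_sum, hn]; ring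
  · push_cast; ring
  · push_cast; ring
  · simp

lemma IsBareRoot.edgeJoin_leaf [Finite V] [Finite W] [Subsingleton W] (h : G.IsBareRoot v) :
    (G.edgeJoin H v w).IsLeafyRoot (.inl v) := by
  obtain ⟨n, P, Q, B, a', b', c', hF', hc, hn, rfl, rfl, rfl⟩ := h
  have : Unique W := { default := w, uniq := fun _ ↦ Subsingleton.elim _ _ }
  refine ⟨_, _, _, _, _, _, _, hF', hc.edgeJoin hasRootCounts_of_subsingleton, ?_, ?_, ?_, ?_⟩
  · rw [Nat.card_sum, hn, Nat.card_unique]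
  · push_cast; ring
  · push_cast; ring
  · simp

lemma IsBareRoot.of_iso (e : G ≃g H) (h : G.IsBareRoot v) : H.IsBareRoot (e v) := by
  obtain ⟨n, P, Q, B, a, b, c, hF, hc, hn, h⟩ := h
  exact ⟨n, P, Q, B, a, b, c, hF, hc.of_iso e, Nat.card_congr e.toEquiv ▸ hn, h⟩

lemma IsLeafyRoot.of_iso (e : G ≃g H) (h : G.IsLeafyRoot v) : H.IsLeafyRoot (e v) := by
  obtain ⟨n, P, Q, B, a, b, c, hF, hc, hn, h⟩ := h
  exact ⟨n, P, Q, B, a, b, c, hF, hc.of_iso e, Nat.card_congr e.toEquiv ▸ hn, h⟩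

lemma Connected.exists_adj (hG : G.Connected) [Nontrivial V] (v : V) : ∃ w, G.Adj v w :=
  hG.preconnected.exists_adj_of_nontrivial v

/-- A rooted tree without twins off the root is built from branches, with or without a leaf at the
root; in the former case a leaf at the root is a vertex with the root as its only neighbour. -/
theorem IsTree.isBareRoot_or_isLeafyRoot [Finite V] (hG : G.IsTree) (hT : G.IsTwinFreeOff v) :
    G.IsBareRoot v ∨ (G.IsLeafyRoot v ∧ ∃ x ≠ v, ∀ z, G.Adj x z ↔ z = v) := by
  induction hN : Nat.card V using Nat.strong_induction_on generalizing V with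
  | _ N ih =>
    subst hN
    rcases subsingleton_or_nontrivial V with hs | hs
    · have : Unique V := { default := v, uniq := fun _ ↦ Subsingleton.elim _ _ }
      exact .inl ⟨0, 1, 1, 1, 1, 0, 1, .inl ⟨rfl, rfl, rfl, rfl⟩, hasRootCounts_of_subsingleton,
        by simp, by simp, by simp, by simp⟩
    · obtain ⟨w, hvw⟩ := hG.1.exists_adj v
      obtain ⟨A, B, _, _, K, L, a, b, e, hK, hL, rfl, rfl⟩ := hG.exists_edgeJoin_iso hvw
      have hT' := hT.of_iso e
      have hcard : Nat.card V = Nat.card A + Nat.card B := by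
        rw [← Nat.card_congr e.toEquiv, Nat.card_sum]
      have : Nonempty A := ⟨a⟩
      have : Nonempty B := ⟨b⟩
      have hA : 0 < Nat.card A := Nat.card_pos
      have hB : 0 < Nat.card B := Nat.card_pos
      have ihA := ih _ (by omega) hK hT'.of_edgeJoin_left rfl
      have ihB := ih _ (by omega) hL hT'.of_edgeJoin_right rfl
      rcases subsingleton_or_nontrivial B with hB1 | hB1
      · have hleaf : ∀ z, (K.edgeJoin L a b).Adj (.inr b) z ↔ z = .inl a := by
          rintro (z | z)
          · simp
          · simp [Subsingleton.elim z b]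
        rcases ihA with hA | ⟨_, x, hxa, hx⟩
        · refine .inr ⟨hA.edgeJoin_leaf.of_iso e, e (.inr b), by simp, fun z ↦ ?_⟩
          obtain ⟨z, rfl⟩ := e.surjective z
          rw [e.map_adj_iff, hleaf, e.injective.eq_iff]
        · refine absurd (hT' (x := .inl x) (y := .inr b) (by simpa using hxa) (by simp) ?_)
            (by simp)
          intro z
          rw [hleaf]
          rcases z with z | z <;> simp [hx, hxa]
      · obtain ⟨a', b', c', hc, hF⟩ : ∃ a' b' c' : ℕ, L.HasRootCounts b a' b' c' ∧
            BranchForest (Nat.card B) (b' + c') (a' + b') b' := by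
          rcases ihB with hB | ⟨hB, _⟩
          · exact hB.branchForest (Finite.one_lt_card)
          · exact hB.branchForest
        rcases ihA with hA | ⟨hA, x, hxa, hx⟩
        · exact .inl ((hA.edgeJoin_branch hc hF).of_iso e)
        · refine .inr ⟨(hA.edgeJoin_branch hc hF).of_iso e, e (.inl x), by simpa using hxa, ?_⟩
          intro z
          obtain ⟨z, rfl⟩ := e.surjective z
          rw [e.map_adj_iff, e.injective.eq_iff]
          rcases z with z | z <;> simp [hx, hxa]

lemma IsTree.exists_leaf [Finite V] [Nontrivial V] (hG : G.IsTree) :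
    ∃ v x, x ≠ v ∧ ∀ z, G.Adj x z ↔ z = v := by
  classical
  have := Fintype.ofFinite V
  obtain ⟨x, hx⟩ := hG.exists_vert_degree_one_of_nontrivial
  obtain ⟨v, hv, huniq⟩ := degree_eq_one_iff_existsUnique_adj.1 hx
  exact ⟨v, x, hv.ne, fun z ↦ ⟨huniq z, fun h ↦ h ▸ hv⟩⟩

/-- The lower bound on the number of maximal independent sets. -/
theorem IsTree.twinFreeTreeBound_le [Finite V] (hG : G.IsTree) (hT : G.IsTwinFree)
    (hV : 4 ≤ Nat.card V) : twinFreeTreeBound (Nat.card V) ≤ G.numMaximalIndepSets := by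
  have : Nontrivial V := Finite.one_lt_card_iff_nontrivial.1 (by omega)
  obtain ⟨v, x, hxv, hx⟩ := hG.exists_leaf
  obtain ⟨A, B, _, _, K, L, a, b, e, hK, hL, rfl, rfl⟩ :=
    hG.exists_edgeJoin_iso (((hx v).2 rfl).symm)
  have hleaf : ∀ z, (K.edgeJoin L a b).Adj (.inr b) z ↔ z = .inl a := by
    intro z
    rw [← e.map_adj_iff, hx, e.injective.eq_iff]
  have hB : Subsingleton B := by
    by_contra hB
    rw [not_subsingleton_iff_nontrivial] at hB
    obtain ⟨z, hz⟩ := hL.1.exists_adj b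
    exact absurd ((hleaf (.inr z)).1 hz) (by simp)
  have hT' := (hT.isTwinFreeOff (v := e (.inl a))).of_iso e
  obtain h | ⟨_, y, hya, hy⟩ := hK.isBareRoot_or_isLeafyRoot hT'.of_edgeJoin_left
  · obtain ⟨n, P, Q, C, a, b, c, hF, hc, hn, rfl, rfl, rfl⟩ :=
      (h.edgeJoin_leaf (H := L) (w := b)).of_iso e
    rcases hF with ⟨rfl, _⟩ | hF
    · omega
    · rw [hn, hc.numMaximalIndepSets_eq]
      exact_mod_cast hF.twinFreeTreeBound_le
  · refine absurd (hT' (x := .inl y) (y := .inr b) (by simpa using hya) (by simp) ?_) (by simp)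
    intro z
    rw [hleaf]
    rcases z with z | z <;> simp [hy, hya]

end SimpleGraph

namespace SimpleGraph

section edgeJoin
variable {V W : Type*} {G : SimpleGraph V} {H : SimpleGraph W} {v : V} {w : W}

lemma edgeJoin_eq_sup : G.edgeJoin H v w = (G ⊕g H) ⊔ edge (.inl v) (.inr w) := by
  ext (x | x) (y | y) <;> simp [edge_adj, eq_comm, and_comm]

lemma IsTree.edgeJoin [Finite V] [Finite W] (hG : G.IsTree) (hH : H.IsTree) :
    (G.edgeJoin H v w).IsTree := by
  have hconn : (G.edgeJoin H v w).Connected := edgeJoin_eq_sup ▸ hG.1.sum_sup_edge hH.1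
  rw [isTree_iff_connected_and_card] at hG hH ⊢
  refine ⟨hconn, le_antisymm ?_ hconn.card_vert_le_card_edgeSet_add_one⟩
  have h1 : (G.edgeJoin H v w).edgeSet ⊆ (G ⊕g H).edgeSet ∪ {s(.inl v, .inr w)} := by
    rw [edgeJoin_eq_sup, edgeSet_sup]
    exact Set.union_subset_union_right _ (by simp [edge, edgeSet_fromEdgeSet])
  have h2 := (Set.ncard_le_ncard h1 (Set.toFinite _)).trans (Set.ncard_union_le _ _)
  have h3 := Nat.card_congr (edgeSetSumEquiv (G := G) (H := H))
  rw [Nat.card_sum] at h3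
  rw [Set.ncard_singleton] at h2
  simp only [← Nat.card_coe_set_eq] at h2
  rw [Nat.card_sum]
  omega

lemma IsTwinFreeOff.stem (hH : H.IsTwinFreeOff w) [Subsingleton V] :
    (G.edgeJoin H v w).IsTwinFreeOff (.inl v) := by
  rintro (x | x) (y | y) hx hy hxy
  · exact absurd (congrArg _ (Subsingleton.elim x v)) hx
  · exact absurd (congrArg _ (Subsingleton.elim x v)) hx
  · exact absurd (congrArg _ (Subsingleton.elim y v)) hy
  · have hroot : x = w ↔ y = w := by simpa using hxy (.inl v)
    by_cases e : x = w
    · rw [e, hroot.1 e]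
    · rw [hH e (fun h ↦ e (hroot.2 h)) fun z ↦ by simpa using hxy (.inr z)]

lemma IsTwinFreeOff.isTwinFree_edgeJoin (hG : G.IsTwinFreeOff v) (hH : H.IsTwinFreeOff w)
    (hGadj : ∀ x, ∃ y, G.Adj x y) (hHadj : ∀ x, ∃ y, H.Adj x y) :
    (G.edgeJoin H v w).IsTwinFree := by
  have mixed {x y} (hxy : ∀ z, (G.edgeJoin H v w).Adj (.inl x) z ↔
      (G.edgeJoin H v w).Adj (.inr y) z) : False := by
    obtain ⟨z, hz⟩ := hGadj x
    obtain ⟨z', hz'⟩ := hHadj y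
    obtain ⟨rfl, -⟩ : z = v ∧ y = w := by simpa using (hxy (.inl z)).1 hz
    obtain ⟨rfl, -⟩ : x = z ∧ z' = w := by simpa using (hxy (.inr z')).2 hz'
    exact hz.ne rfl
  intro x y hxy
  replace hxy := Set.ext_iff.1 hxy
  simp only [mem_neighborSet] at hxy
  rcases x with x | x <;> rcases y with y | y
  · have hroot : x = v ↔ y = v := by simpa using hxy (.inr w)
    by_cases e : x = v
    · rw [e, hroot.1 e]
    · rw [hG e (fun h ↦ e (hroot.2 h)) fun z ↦ by simpa using hxy (.inl z)]
  · exact (mixed hxy).elim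
  · exact (mixed fun z ↦ (hxy z).symm).elim
  · have hroot : x = w ↔ y = w := by simpa using hxy (.inl v)
    by_cases e : x = w
    · rw [e, hroot.1 e]
    · rw [hH e (fun h ↦ e (hroot.2 h)) fun z ↦ by simpa using hxy (.inr z)]

end edgeJoin

/-- Some rooted tree on `n` vertices, without twins off the root, has the given counts. -/
def IsRootedRealizable (n a b c : ℕ) : Prop :=
  ∃ (V : Type) (_ : Finite V) (G : SimpleGraph V) (v : V),
    G.IsTree ∧ Nat.card V = n ∧ G.IsTwinFreeOff v ∧ G.HasRootCounts v a b c

/-- Some rooted twin-free tree on `n` vertices has the given counts. -/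
def IsRealizable (n a b c : ℕ) : Prop :=
  ∃ (V : Type) (_ : Finite V) (G : SimpleGraph V) (v : V),
    G.IsTree ∧ Nat.card V = n ∧ G.IsTwinFree ∧ G.HasRootCounts v a b c

lemma IsRealizable.rooted {n a b c : ℕ} (h : IsRealizable n a b c) :
    IsRootedRealizable n a b c := by
  obtain ⟨V, hV, G, v, h1, h2, h3, h4⟩ := h
  exact ⟨V, hV, G, v, h1, h2, h3.isTwinFreeOff, h4⟩

lemma isRootedRealizable_one : IsRootedRealizable 1 1 0 1 :=
  ⟨Unit, inferInstance, ⊥, (), .of_subsingleton, by simp, fun _ _ _ _ _ ↦ rfl,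
    hasRootCounts_of_subsingleton⟩

lemma IsRootedRealizable.stem {n a b c : ℕ} (h : IsRootedRealizable n a b c) :
    IsRootedRealizable (n + 1) (b + c) a b := by
  obtain ⟨V, hV, G, v, h1, rfl, h3, h4⟩ := h
  have h5 := (hasRootCounts_of_subsingleton (G := (⊥ : SimpleGraph Unit)) (v := ())).edgeJoin h4
  refine ⟨Unit ⊕ V, inferInstance, edgeJoin ⊥ G () v, .inl (), IsTree.of_subsingleton.edgeJoin h1, ?_, h3.stem, ?_⟩
  · rw [Nat.card_sum, Nat.card_unique, add_comm]
  · simpa using h5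

lemma IsRootedRealizable.join {n a b c n' a' b' c' : ℕ} (h : IsRootedRealizable n a b c)
    (h' : IsRootedRealizable n' a' b' c') (hn : 2 ≤ n) (hn' : 2 ≤ n') :
    IsRealizable (n + n') (a * (b' + c')) (b * (a' + b') + c * a') (c * b') := by
  obtain ⟨V, hV, G, v, h1, rfl, h3, h4⟩ := h
  obtain ⟨W, hW, H, w, k1, rfl, k3, k4⟩ := h'
  have : Nontrivial V := Finite.one_lt_card_iff_nontrivial.1 hn
  have : Nontrivial W := Finite.one_lt_card_iff_nontrivial.1 hn'
  exact ⟨V ⊕ W, inferInstance, _, _, h1.edgeJoin k1, Nat.card_sum,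
    h3.isTwinFree_edgeJoin k3 h1.1.exists_adj k1.1.exists_adj, h4.edgeJoin k4⟩

lemma isRootedRealizable_two : IsRootedRealizable 2 1 1 0 := isRootedRealizable_one.stem
lemma isRootedRealizable_three : IsRootedRealizable 3 1 1 1 := isRootedRealizable_two.stem
lemma isRealizable_four : IsRealizable 4 1 2 0 :=
  isRootedRealizable_two.join isRootedRealizable_two le_rfl le_rfl
lemma isRootedRealizable_five : IsRootedRealizable 5 2 1 2 := isRealizable_four.rooted.stem
lemma isRealizable_five : IsRealizable 5 2 2 0 :=
  isRootedRealizable_two.join isRootedRealizable_three le_rfl (by norm_num)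
lemma isRealizable_six : IsRealizable 6 1 4 0 :=
  isRealizable_four.rooted.join isRootedRealizable_two (by norm_num) le_rfl
lemma isRealizable_seven : IsRealizable 7 3 3 0 :=
  isRootedRealizable_two.join isRootedRealizable_five le_rfl (by norm_num)
lemma isRealizable_eight : IsRealizable 8 4 4 0 :=
  isRealizable_five.rooted.join isRootedRealizable_three (by norm_num) (by norm_num)

lemma IsRealizable.add_five {n a b : ℕ} (h : IsRealizable n a b 0) (hn : 2 ≤ n) :
    IsRealizable (n + 5) (a * 3) (b * 3) 0 := by
  simpa using h.rooted.join isRootedRealizable_five hn (by norm_num)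

lemma exists_isRealizable (n : ℕ) (hn : 4 ≤ n) :
    ∃ a b, IsRealizable n a b 0 ∧ a + b = twinFreeTreeBound n := by
  induction n using Nat.strong_induction_on with
  | _ n ih =>
    by_cases h : n ≤ 8
    · interval_cases n
      · exact ⟨_, _, isRealizable_four, by decide⟩
      · exact ⟨_, _, isRealizable_five, by decide⟩
      · exact ⟨_, _, isRealizable_six, by decide⟩
      · exact ⟨_, _, isRealizable_seven, by decide⟩
      · exact ⟨_, _, isRealizable_eight, by decide⟩
    · obtain ⟨m, rfl⟩ : ∃ m, n = m + 5 := ⟨n - 5, by omega⟩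
      obtain ⟨a, b, hr, hab⟩ := ih m (by omega) (by omega)
      refine ⟨_, _, hr.add_five (by omega), ?_⟩
      rw [twinFreeTreeBound_add_five (by omega), ← hab]
      ring

lemma IsTwinFree.of_iso {V W : Type*} {G : SimpleGraph V} {H : SimpleGraph W} (e : G ≃g H)
    (h : G.IsTwinFree) : H.IsTwinFree := by
  intro x y hxy
  obtain ⟨x, rfl⟩ := e.surjective x
  obtain ⟨y, rfl⟩ := e.surjective y
  refine congrArg e (h (Set.ext fun z ↦ ?_))
  simpa only [mem_neighborSet, e.map_adj_iff] using Set.ext_iff.1 hxy (e z)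

lemma IsRealizable.exists_fin {n a b c : ℕ} (h : IsRealizable n a b c) :
    ∃ T : SimpleGraph (Fin n), T.IsTree ∧ T.IsTwinFree ∧ T.numMaximalIndepSets = a + b := by
  obtain ⟨V, hV, G, v, h1, h2, h3, h4⟩ := h
  let e := Iso.map (Finite.equivFinOfCardEq h2) G
  exact ⟨_, e.isTree_iff.1 h1, h3.of_iso e, (h4.of_iso e).numMaximalIndepSets_eq⟩

end SimpleGraph

theorem theorem3 (n : ℕ) (hn : 4 ≤ n) :
    (∀ (V : Type*) [Fintype V] (T : SimpleGraph V), Fintype.card V = n → T.IsTree →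
      T.IsTwinFree → twinFreeTreeBound n ≤ T.numMaximalIndepSets) ∧
    (∃ T : SimpleGraph (Fin n), T.IsTree ∧ T.IsTwinFree ∧
      T.numMaximalIndepSets = twinFreeTreeBound n) := by
  refine ⟨fun V _ T hV hT htf ↦ ?_, ?_⟩
  · rw [← Nat.card_eq_fintype_card] at hV
    subst hV
    exact hT.twinFreeTreeBound_le htf hn
  · obtain ⟨a, b, hr, hab⟩ := SimpleGraph.exists_isRealizable n hn
    exact hab ▸ hr.exists_fin
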